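/- Let $X$ and $K$ be compact Hausdorff spaces and let $f : K \to X$ be a projective cover of $X$. That is, $f$ is a continuous surjection; $K$ is projective in the category of compact Hausdorff spaces and continuous maps; and $f$ is essential, i.e. whenever $Y$ is compact Hausdorff and $h : Y \to K$ is continuous with $f(h(Y)) = X$, then $h(Y) = K$. Let $\pi_f : C(X) \to C(K)$, $\pi_f(g) = g \circ f$. Consider the category of operator systems (self-adjoint linear subspaces of unital $C^*$-algebras that contain the unit, with the matrix order of the $C^*$-algebra) and unital completely positive (u.c.p.) maps. An injective envelope of an operator system $S$ is a pair $(I, \kappa)$ in which $I$ is an injective operator system, $\kappa : S \to I$ is a unital complete order embedding, and the identity is the only u.c.p. map $\varphi : I \to I$ with $\varphi \circ \kappa = \kappa$. If an injective operator system $I$ lies in the unital $C^*$-algebra $A$, it is regarded as a $C^*$-algebra with its own linear structure, involution and norm and the Choi–Effros product $x \circ y = \Phi(xy)$, where $\Phi : A \to I$ is a u.c.p. map that fixes every element of $I$. Then: 1. $(C(K), \pi_f)$ is an injective envelope of $C(X)$. 2. Let $(I, \kappa)$ be any injective envelope of $C(X)$, with $I \subseteq A$ as above. Then a u.c.p. map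 $\Phi : A \to I$ that fixes $I$ exists, and there is a u.c.p. map $\theta : C(K) \to I$ that is a complete order embedding, is isometric, satisfies $\theta(g \circ f) = \kappa(g)$ for all $g \in C(X)$, and is, for every such $\Phi$, a $*$-isomorphism of $C(K)$ onto $I$ with the product $x \circ y = \Phi(xy)$. So $C(K)$ is $*$-isomorphic to Hamana's injective envelope $I(C(X))$ by a $*$-isomorphism that fixes $C(X)$. -/

import Mathlib

universe u

/-! ### Operator systems and unital completely positive maps -/

/-- An operator system in a unital C⋆-algebra `A`: a self-adjoint linear subspace that contains the
unit of `A`. Matrices over it are ordered as matrices over `A`. -/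
structure OperatorSystem (A : Type u) [CStarAlgebra A] extends Submodule ℂ A where
  one_mem' : (1 : A) ∈ carrier
  star_mem' : ∀ a ∈ carrier, star a ∈ carrier

namespace OperatorSystem

section Basic

variable {A : Type u} [CStarAlgebra A]

/-- The elements of an operator system, as a type. -/
abbrev Elem (S : OperatorSystem A) : Type u := S.toSubmodule

instance (S : OperatorSystem A) : One S.Elem := ⟨⟨1, S.one_mem'⟩⟩

instance (S : OperatorSystem A) : Star S.Elem := ⟨fun a => ⟨star (a : A), S.star_mem' a a.2⟩⟩

/-- A unital C⋆-algebra, regarded as an operator system. -/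
noncomputable def top (A : Type u) [CStarAlgebra A] : OperatorSystem A where
  toSubmodule := ⊤
  one_mem' := trivial
  star_mem' _ _ := trivial

/-- An element of the C⋆-algebra `A`, regarded as an element of the operator system `A`. -/
noncomputable def toTop (a : A) : (top A).Elem := ⟨a, trivial⟩

end Basic

end OperatorSystem

open OperatorSystem

/-- A square matrix over an operator system `S` in `A` is positive when it is a positive element of
the C⋆-algebra `M_n(A)`, i.e. of the form `N⋆ N` with `N ∈ M_n(A)`. -/
def OperatorSystem.MatrixNonneg {A : Type u} [CStarAlgebra A]
    (S : OperatorSystem A) {n : ℕ} (M : Matrix (Fin n) (Fin n) S.Elem) : Prop :=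
  ∃ N : Matrix (Fin n) (Fin n) A, M.map (fun s => (s : A)) = N.conjTranspose * N

/-- Unital completely positive linear maps between operator systems. -/
structure UCPMap {A B : Type u} [CStarAlgebra A] [CStarAlgebra B]
    (S : OperatorSystem A) (T : OperatorSystem B) extends S.Elem →ₗ[ℂ] T.Elem where
  map_one' : toFun 1 = 1
  map_matrixNonneg' : ∀ (n : ℕ) (M : Matrix (Fin n) (Fin n) S.Elem),
    S.MatrixNonneg M → T.MatrixNonneg (M.map toFun)

namespace UCPMap

variable {A B : Type u} [CStarAlgebra A] [CStarAlgebra B]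

instance (S : OperatorSystem A) (T : OperatorSystem B) :
    CoeFun (UCPMap S T) (fun _ => S.Elem → T.Elem) := ⟨fun φ => φ.toFun⟩

/-- `φ` is a complete order embedding: a matrix is positive if and only if its image is (one
direction being complete positivity). -/
def IsCompleteOrderEmbedding {S : OperatorSystem A} {T : OperatorSystem B} (φ : UCPMap S T) :
    Prop :=
  ∀ (n : ℕ) (M : Matrix (Fin n) (Fin n) S.Elem), T.MatrixNonneg (M.map φ) → S.MatrixNonneg M

/-- A unital ⋆-homomorphism of unital C⋆-algebras, as a unital completely positive map. -/
noncomputable def ofStarAlgHom (π : A →⋆ₐ[ℂ] B) : UCPMap (top A) (top B) where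
  toFun a := toTop (π a)
  map_add' a b := Subtype.ext (map_add π (a : A) (b : A))
  map_smul' c a := Subtype.ext (map_smul π c (a : A))
  map_one' := Subtype.ext (map_one π)
  map_matrixNonneg' n M := by
    rintro ⟨N, hN⟩
    refine ⟨N.map π, ?_⟩
    ext i j
    have h := congrArg π (congrFun (congrFun hN i) j)
    simpa [Matrix.mul_apply, toTop, map_star] using h

end UCPMap

/-! ### Injectivity and injective envelopes -/

section Injective

variable {A B : Type u} [CStarAlgebra A] [CStarAlgebra B]

/-- `I` is injective in the category of operator systems and unital completely positive maps: every
such map from a subsystem `S` of an operator system `T` into `I` extends to `T`. -/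
def OperatorSystem.IsInjective (I : OperatorSystem A) : Prop :=
  ∀ (D : Type u) [CStarAlgebra D]
    (S T : OperatorSystem D) (hST : S.toSubmodule ≤ T.toSubmodule) (φ : UCPMap S I),
    ∃ ψ : UCPMap T I, ∀ s : S.Elem, ψ (Submodule.inclusion hST s) = φ s

/-- `(I, κ)` is an injective envelope of `S` in the category of operator systems and unital
completely positive maps: it is an extension of `S`, it is injective, and it is rigid, i.e. the
identity is the only unital completely positive map `I → I` that fixes the image of `S`. -/
structure UCPMap.IsInjectiveEnvelope {S : OperatorSystem A} {I : OperatorSystem B}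
    (κ : UCPMap S I) : Prop where
  embedding : κ.IsCompleteOrderEmbedding
  injective : I.IsInjective
  rigid : ∀ φ : UCPMap I I, (∀ s : S.Elem, φ (κ s) = κ s) → ∀ x : I.Elem, φ x = x

/-- `Φ` is a unital completely positive retraction of the C⋆-algebra `A` onto `I ⊆ A`. -/
def UCPMap.IsRetraction {I : OperatorSystem A} (Φ : UCPMap (top A) I) : Prop :=
  ∀ x : I.Elem, Φ (toTop (x : A)) = x

/-- An operator system `I ⊆ A` with the Choi–Effros product `x ∘ y = Φ (x y)` given by a retraction
`Φ` of `A` onto `I`; the linear structure and the involution are those of `I`. This is how an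
injective operator system is regarded as a C⋆-algebra. -/
def ChoiEffros (I : OperatorSystem A) (_ : UCPMap (top A) I) : Type u := I.Elem

namespace ChoiEffros

variable {I : OperatorSystem A} {Φ : UCPMap (top A) I}

noncomputable instance : AddCommGroup (ChoiEffros I Φ) := inferInstanceAs (AddCommGroup I.Elem)

noncomputable instance : Module ℂ (ChoiEffros I Φ) := inferInstanceAs (Module ℂ I.Elem)

instance : Star (ChoiEffros I Φ) := inferInstanceAs (Star I.Elem)

/-- The identity map to the underlying operator system. -/
def toElem (x : ChoiEffros I Φ) : I.Elem := x

noncomputable instance : Mul (ChoiEffros I Φ) :=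
  ⟨fun x y => Φ (toTop ((x.toElem : A) * (y.toElem : A)))⟩

end ChoiEffros

end Injective

/-! ### Projective covers of compact Hausdorff spaces -/

/-- `(K, f)` is an essential cover of `X`: `f` is onto, and a continuous map `h` from a compact
Hausdorff space to `K` is onto as soon as `f ∘ h` is. -/
def IsEssentialCover {X K : Type u} [TopologicalSpace X] [TopologicalSpace K] (f : C(K, X)) :
    Prop :=
  Function.Surjective f ∧
    ∀ (Y : Type u) [TopologicalSpace Y] [CompactSpace Y] [T2Space Y] (h : C(Y, K)),
      Function.Surjective (f ∘ h) → Function.Surjective h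

/-- `(K, f)` is a projective cover of `X`: an essential cover with `K` projective among compact
Hausdorff spaces. -/
def IsProjectiveCover {X K : Type u} [TopologicalSpace X] [TopologicalSpace K] (f : C(K, X)) :
    Prop :=
  IsEssentialCover f ∧ CompactT2.Projective K

/-- Composition with `f`, as a unital completely positive map `C(X) → C(K)`. -/
noncomputable def pullbackUCP {X K : Type u} [TopologicalSpace X] [CompactSpace X]
    [TopologicalSpace K] [CompactSpace K] (f : C(K, X)) :
    UCPMap (top C(X, ℂ)) (top C(K, ℂ)) :=
  UCPMap.ofStarAlgHom (ContinuousMap.compStarAlgHom' ℂ ℂ f)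

/-! Injectivity of `C(K)`: a u.c.p. map into `C(K)` is a family of states indexed by `K`. Each state
extends to the larger C⋆-algebra by a Riesz extension argument. All the extensions together form a
compact space over `K`, and projectivity of `K` provides a continuous section of it, which is an
extended map (`isInjective_top_of_projective`).

Rigidity: a u.c.p. map on `C(K)` that fixes `C(X)` has its values at `k` bounded by what happens on
the fibre of `f` through `k`. Essentiality sharpens this to `φ h ≤ h` for real `h`, and `-h` gives
the reverse (`UCPMap.apply_eq_of_isEssentialCover`).

Uniqueness: extending `κ` and `pullbackUCP f` along each other gives `θ` and `ψ`, mutually inverse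
by the two rigidities. The Kadison–Schwarz inequality for `θ` and for `ψ ∘ Φ` then forces `θ` to
carry the product of `C(K)` to the Choi–Effros product. -/

open scoped ComplexOrder

/-! ### Positivity -/

section Positivity

variable {A : Type u} [CStarAlgebra A] [PartialOrder A] [StarOrderedRing A]

/-- A positive linear map on an operator system is self-adjoint. -/
theorem OperatorSystem.map_star_of_nonneg {E : Type*} [Ring E] [PartialOrder E] [StarRing E]
    [StarOrderedRing E] [Module ℂ E] [StarModule ℂ E]
    (S : OperatorSystem A) (f : S.Elem →ₗ[ℂ] E) (hf : ∀ s : S.Elem, 0 ≤ (s : A) → 0 ≤ f s)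
    (s : S.Elem) : f (star s) = star (f s) := by
  -- A self-adjoint `h` is the difference of `‖h‖ • 1` and `‖h‖ • 1 - h`, both positive and both in
  -- `S`.
  have key : ∀ h : S.Elem, IsSelfAdjoint (h : A) → star (f h) = f h := by
    intro h hh
    have h1 : 0 ≤ (((‖(h : A)‖ : ℂ) • (1 : S.Elem) : S.Elem) : A) := by
      have : (((‖(h : A)‖ : ℂ) • (1 : S.Elem) : S.Elem) : A) = algebraMap ℝ A ‖(h : A)‖ := by
        rw [Algebra.algebraMap_eq_smul_one]; rfl
      rw [this]
      exact algebraMap_nonneg A (norm_nonneg _)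
    have h2 : 0 ≤ (((‖(h : A)‖ : ℂ) • (1 : S.Elem) - h : S.Elem) : A) := by
      have : (((‖(h : A)‖ : ℂ) • (1 : S.Elem) - h : S.Elem) : A) =
          algebraMap ℝ A ‖(h : A)‖ - h := by
        rw [Algebra.algebraMap_eq_smul_one]; rfl
      rw [this, sub_nonneg]
      exact hh.le_algebraMap_norm_self
    have e1 := (IsSelfAdjoint.of_nonneg (hf _ h1)).star_eq
    have e2 := (IsSelfAdjoint.of_nonneg (hf _ h2)).star_eq
    rw [map_sub, star_sub, e1] at e2
    exact sub_right_injective e2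
  have hu := key (s + star s) (IsSelfAdjoint.add_star_self (s : A))
  have hv := key (Complex.I • (s - star s)) (by
    have : ((Complex.I • (s - star s) : S.Elem) : A) = Complex.I • ((s : A) - star (s : A)) := rfl
    rw [this, isSelfAdjoint_iff, star_smul, star_sub, star_star]
    simp [smul_sub]
    abel)
  rw [map_add, star_add] at hu
  rw [map_smul, map_sub, star_smul, star_sub] at hv
  have hv' : star (f s) - star (f (star s)) = f (star s) - f s := by
    have := congrArg (fun x => Complex.I • x) hv
    simpa [smul_smul] using this
  have h2 : (2 : ℂ) • f (star s) = (2 : ℂ) • star (f s) := by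
    rw [two_smul, two_smul]
    have := congrArg₂ (· + ·) hu hv'
    have e1 : star (f s) + star (f (star s)) + (star (f s) - star (f (star s))) =
        star (f s) + star (f s) := by abel
    have e2 : f s + f (star s) + (f (star s) - f s) = f (star s) + f (star s) := by abel
    exact (e1.symm.trans (this.trans e2)).symm
  exact smul_right_injective E two_ne_zero h2

theorem OperatorSystem.matrixNonneg_fin_one_iff (S : OperatorSystem A) (s : S.Elem) :
    S.MatrixNonneg (Matrix.of fun _ _ : Fin 1 => s) ↔ 0 ≤ (s : A) := by
  rw [CStarAlgebra.nonneg_iff_eq_star_mul_self]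
  constructor
  · rintro ⟨N, hN⟩
    refine ⟨N 0 0, ?_⟩
    simpa [Matrix.mul_apply] using congrFun (congrFun hN 0) 0
  · rintro ⟨b, hb⟩
    refine ⟨Matrix.of fun _ _ => b, ?_⟩
    ext i j
    simpa [Matrix.mul_apply] using hb

variable {B : Type u} [CStarAlgebra B] [PartialOrder B] [StarOrderedRing B]
  {S : OperatorSystem A} {T : OperatorSystem B}

theorem UCPMap.map_nonneg (φ : UCPMap S T) {s : S.Elem} (hs : 0 ≤ (s : A)) : 0 ≤ (φ s : B) :=
  (T.matrixNonneg_fin_one_iff _).1 (φ.map_matrixNonneg' 1 _ ((S.matrixNonneg_fin_one_iff s).2 hs))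

theorem UCPMap.map_star (φ : UCPMap S T) (s : S.Elem) : φ (star s) = star (φ s) :=
  Subtype.ext (S.map_star_of_nonneg (T.toSubmodule.subtype ∘ₗ φ.toLinearMap)
    (fun _ hs => φ.map_nonneg hs) s)

/-- The Kadison–Schwarz inequality. -/
theorem UCPMap.star_mul_le (φ : UCPMap (top A) T) (a : A) :
    star (φ (toTop a) : B) * (φ (toTop a) : B) ≤ (φ (toTop (star a * a)) : B) := by
  -- This matrix is `R⋆ R` for the row `R = (1, a)`, padded with a zero row. Positivity of its
  -- image, whose corner is `1`, yields the inequality as a Schur complement.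
  have hP : (top A).MatrixNonneg (!![toTop 1, toTop a; toTop (star a), toTop (star a * a)]) := by
    refine ⟨!![1, a; 0, 0], ?_⟩
    ext i j
    fin_cases i <;> fin_cases j <;> simp [Matrix.mul_apply, toTop]
  obtain ⟨N, hN⟩ := φ.map_matrixNonneg' 2 _ hP
  have h1 : φ (toTop (1 : A)) = 1 := φ.map_one'
  have h1' : ((1 : T.Elem) : B) = 1 := rfl
  have hs : φ (toTop (star a)) = star (φ (toTop a)) := φ.map_star (toTop a)
  have hs' : ((star (φ (toTop a)) : T.Elem) : B) = star (φ (toTop a) : B) := rfl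
  have h (i j) := congrFun (congrFun hN i) j
  have h00 := h 0 0
  have h01 := h 0 1
  have h10 := h 1 0
  have h11 := h 1 1
  simp only [Matrix.map_apply, Matrix.of_apply, Matrix.cons_val', Matrix.cons_val_zero,
    Matrix.cons_val_one, Matrix.cons_val_fin_one, Matrix.mul_apply, Matrix.conjTranspose_apply,
    Fin.sum_univ_two] at h00 h01 h10 h11
  change (φ (toTop (1 : A)) : B) = _ at h00
  change (φ (toTop a) : B) = _ at h01
  change (φ (toTop (star a)) : B) = _ at h10
  change (φ (toTop (star a * a)) : B) = _ at h11
  rw [h1, h1'] at h00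
  rw [hs, hs'] at h10
  set b := (φ (toTop a) : B)
  rw [← sub_nonneg, h11]
  have key : ∀ k : Fin 2, 0 ≤ star (N k 1 - N k 0 * b) * (N k 1 - N k 0 * b) :=
    fun k => star_mul_self_nonneg _
  have e : star (N 0 1) * N 0 1 + star (N 1 1) * N 1 1 - star b * b =
      star (N 0 1 - N 0 0 * b) * (N 0 1 - N 0 0 * b) +
      star (N 1 1 - N 1 0 * b) * (N 1 1 - N 1 0 * b) := by
    have e1 : star (N 0 1 - N 0 0 * b) * (N 0 1 - N 0 0 * b) +
      star (N 1 1 - N 1 0 * b) * (N 1 1 - N 1 0 * b) =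
      (star (N 0 1) * N 0 1 + star (N 1 1) * N 1 1)
       - (star (N 0 1) * N 0 0 + star (N 1 1) * N 1 0) * b
       - star b * (star (N 0 0) * N 0 1 + star (N 1 0) * N 1 1)
       + star b * (star (N 0 0) * N 0 0 + star (N 1 0) * N 1 0) * b := by
      simp only [star_sub, star_mul]
      noncomm_ring
    rw [e1, ← h00, ← h01, ← h10]
    noncomm_ring
  rw [e]
  exact add_nonneg (key 0) (key 1)

/-- Unital completely positive maps on C⋆-algebras are contractive. -/
theorem UCPMap.norm_apply_le (φ : UCPMap (top A) T) (a : A) : ‖(φ (toTop a) : B)‖ ≤ ‖a‖ := by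
  have h1 : 0 ≤ ((((‖a‖ ^ 2 : ℝ) : ℂ) • (1 : (top A).Elem) - toTop (star a * a) :
      (top A).Elem) : A) := by
    have : ((((‖a‖ ^ 2 : ℝ) : ℂ) • (1 : (top A).Elem) - toTop (star a * a) : (top A).Elem) : A) =
        algebraMap ℝ A (‖a‖ ^ 2) - star a * a := by
      rw [Algebra.algebraMap_eq_smul_one]; rfl
    rw [this, sub_nonneg]
    exact CStarAlgebra.star_mul_le_algebraMap_norm_sq
  have h2 := φ.map_nonneg h1
  have h3 : (φ (((‖a‖ ^ 2 : ℝ) : ℂ) • (1 : (top A).Elem) - toTop (star a * a)) : B) =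
      algebraMap ℝ B (‖a‖ ^ 2) - (φ (toTop (star a * a)) : B) := by
    have e : φ (((‖a‖ ^ 2 : ℝ) : ℂ) • (1 : (top A).Elem) - toTop (star a * a)) =
        ((‖a‖ ^ 2 : ℝ) : ℂ) • φ (1 : (top A).Elem) - φ (toTop (star a * a)) :=
      (φ.toLinearMap.map_sub _ _).trans (congrArg (· - _) (φ.toLinearMap.map_smul _ _))
    rw [e, Algebra.algebraMap_eq_smul_one, show φ (1 : (top A).Elem) = 1 from φ.map_one']
    rfl
  rw [h3, sub_nonneg] at h2
  have h4 := (φ.star_mul_le a).trans h2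
  have h5 := (CStarAlgebra.norm_le_iff_le_algebraMap _ (by positivity)
    (star_mul_self_nonneg _)).2 h4
  rw [CStarRing.norm_star_mul_self, ← sq] at h5
  exact (sq_le_sq₀ (norm_nonneg _) (norm_nonneg _)).1 h5

/-- Positive unital functionals on an operator system extend to the surrounding C⋆-algebra. -/
theorem OperatorSystem.exists_functional_extension (S : OperatorSystem A) (ω : S.Elem →ₗ[ℂ] ℂ)
    (hω : ∀ s : S.Elem, 0 ≤ (s : A) → 0 ≤ ω s) (h1 : ω 1 = 1) :
    ∃ Ω : A →ₗ[ℂ] ℂ, (∀ s : S.Elem, Ω s = ω s) ∧ (∀ a, 0 ≤ a → 0 ≤ Ω a) ∧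
      ∀ a, ‖Ω a‖ ≤ 2 * ‖a‖ := by
  have hstar := S.map_star_of_nonneg ω hω
  -- The cone of elements with positive real part. Using it instead of the positive cone lets the
  -- Riesz extension run on all of `A` as a real space, since `‖a‖ • 1 + a` always lies in it.
  let C : PointedCone ℝ A :=
    { carrier := {a | 0 ≤ a + star a}
      add_mem' := fun {a b} ha hb => by
        have := add_nonneg ha hb
        simp only [Set.mem_ofPred_eq, star_add]
        convert this using 1
        abel
      zero_mem' := by simp
      smul_mem' := fun c a ha => by
        have h : (c • a) + star (c • a) = (c : ℝ) • (a + star a) := by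
          rw [smul_add, show star (c • a) = (c : ℝ) • star a from
            (star_smul (c : ℝ) a).trans (by rw [star_trivial])]
          rfl
        simp only [Set.mem_ofPred_eq] at ha ⊢
        rw [h]
        exact smul_nonneg c.2 ha }
  have hC : ∀ a, a ∈ C ↔ 0 ≤ a + star a := fun a => Iff.rfl
  let f : A →ₗ.[ℝ] ℝ :=
    { domain := S.toSubmodule.restrictScalars ℝ
      toFun := Complex.reLm ∘ₗ ω.restrictScalars ℝ }
  have hnorm : ∀ a : A, algebraMap ℝ A ‖a‖ + a ∈ C := by
    intro a
    rw [hC]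
    have h := (IsSelfAdjoint.add_star_self a).neg_algebraMap_norm_le_self
    have h2 : ‖a + star a‖ ≤ ‖a‖ + ‖a‖ := (norm_add_le _ _).trans (by rw [norm_star])
    have h3 : algebraMap ℝ A ‖a + star a‖ ≤ algebraMap ℝ A (‖a‖ + ‖a‖) := algebraMap_mono A h2
    have h4 : -algebraMap ℝ A (‖a‖ + ‖a‖) ≤ a + star a := (neg_le_neg h3).trans h
    rw [neg_le_iff_add_nonneg'] at h4
    convert h4 using 1
    rw [star_add, ← algebraMap_star_comm, star_trivial, map_add]
    abel
  have hmemS : ∀ r : ℝ, algebraMap ℝ A r ∈ S.toSubmodule := by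
    intro r
    rw [Algebra.algebraMap_eq_smul_one]
    exact (S.toSubmodule.restrictScalars ℝ).smul_mem r S.one_mem'
  obtain ⟨g, hg, hgC⟩ := riesz_extension C f
    (by
      intro s' hs
      let s : S.Elem := s'
      have h : 0 ≤ ω (s + star s) := hω _ hs
      rw [map_add, hstar] at h
      have h' := (Complex.nonneg_iff.1 h).1
      simp only [Complex.add_re, RCLike.star_def, Complex.conj_re] at h'
      have h0 : f s' = (ω s).re := rfl
      rw [h0]
      linarith)
    (fun y => ⟨⟨algebraMap ℝ A ‖y‖, hmemS _⟩, hnorm y⟩)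
  have hgs : ∀ s : S.Elem, g s = (ω s).re := fun s => hg s
  have hg1 : ∀ r : ℝ, g (algebraMap ℝ A r) = r := by
    intro r
    rw [Algebra.algebraMap_eq_smul_one, map_smul]
    have := hgs 1
    rw [h1] at this
    rw [show g (1 : A) = 1 from this, smul_eq_mul, mul_one]
  have hgle : ∀ a, |g a| ≤ ‖a‖ := by
    intro a
    have h := hgC _ (hnorm a)
    have h' := hgC _ (hnorm (-a))
    rw [map_add, hg1] at h h'
    rw [map_neg, norm_neg] at h'
    exact abs_le.2 ⟨by linarith, by linarith⟩
  have happ : ∀ a, Module.Dual.extendRCLike (𝕜 := ℂ) g a = (g a : ℂ) - Complex.I * g (Complex.I • a) :=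
    fun a => rfl
  refine ⟨Module.Dual.extendRCLike (𝕜 := ℂ) g, ?_, ?_, ?_⟩
  · intro s
    rw [happ, hgs, show Complex.I • (s : A) = ((Complex.I • s : S.Elem) : A) from rfl, hgs, map_smul]
    apply Complex.ext <;> simp
  · intro a ha
    -- An imaginary multiple of a positive element has zero real part, so it and its negative both
    -- lie in `C`. Hence `g` vanishes on `I • a`, and the complexified functional is real at `a`.
    have hz : ∀ c : ℂ, star c = -c → 0 ≤ g (c • a) := by
      intro c hc
      refine hgC _ ?_
      rw [hC, star_smul, (IsSelfAdjoint.of_nonneg ha).star_eq, hc, neg_smul, add_neg_cancel]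
    have h1 := hz Complex.I (by simp)
    have h2 := hz (-Complex.I) (by simp)
    rw [neg_smul, map_neg] at h2
    have h3 : g (Complex.I • a) = 0 := by linarith
    have h4 : 0 ≤ g a := hgC _ (by
      rw [hC, (IsSelfAdjoint.of_nonneg ha).star_eq]; exact add_nonneg ha ha)
    rw [happ, h3]
    simpa using h4
  · intro a
    rw [happ]
    refine (norm_sub_le _ _).trans ?_
    have h1 := hgle a
    have h2 := hgle (Complex.I • a)
    rw [norm_smul, Complex.norm_I, one_mul] at h2
    rw [norm_mul, Complex.norm_I, one_mul, Complex.norm_real, Complex.norm_real, Real.norm_eq_abs,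
      Real.norm_eq_abs]
    linarith

end Positivity

/-! ### Matrices over `C(K)` -/

section Matrices

open scoped Matrix.Norms.L2Operator MatrixOrder

/-- A matrix of continuous functions that is pointwise positive semidefinite is positive. -/
theorem matrixNonneg_of_posSemidef {K : Type u} [TopologicalSpace K] [CompactSpace K]
    {n : ℕ} (M : Matrix (Fin n) (Fin n) (top C(K, ℂ)).Elem)
    (hM : ∀ k : K, (M.map fun s => (s : C(K, ℂ)) k).PosSemidef) :
    (top C(K, ℂ)).MatrixNonneg M := by
  let m : K → Matrix (Fin n) (Fin n) ℂ := fun k => M.map fun s => (s : C(K, ℂ)) k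
  have hm : Continuous m := continuous_matrix fun i j => (M i j : C(K, ℂ)).continuous
  have hm0 : ∀ k, 0 ≤ m k := fun k => (hM k).nonneg
  -- Pointwise square roots vary continuously with `k`, so they assemble into a matrix over `C(K)`,
  -- the required `N`.
  have hs : Continuous fun k => CFC.sqrt (m k) :=
    CFC.continuousOn_sqrt.comp_continuous hm hm0
  refine ⟨Matrix.of fun i j => ⟨fun k => CFC.sqrt (m k) i j, hs.matrix_elem i j⟩, ?_⟩
  ext i j k
  have h1 := CFC.sqrt_mul_sqrt_self (m k) (hm0 k)
  have h2 : star (CFC.sqrt (m k)) = CFC.sqrt (m k) :=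
    (IsSelfAdjoint.of_nonneg (CFC.sqrt_nonneg (m k))).star_eq
  have h3 : star (CFC.sqrt (m k)) * CFC.sqrt (m k) = m k := by rw [h2, h1]
  have h4 := congrFun (congrFun h3 i) j
  rw [Matrix.mul_apply] at h4
  simp only [Matrix.star_apply] at h4
  have h5 : (M i j : C(K, ℂ)) k = _ := h4.symm
  simpa [Matrix.mul_apply] using h5

theorem posSemidef_of_matrixNonneg {K : Type u} [TopologicalSpace K] [CompactSpace K]
    {n : ℕ} {M : Matrix (Fin n) (Fin n) (top C(K, ℂ)).Elem} (hM : (top C(K, ℂ)).MatrixNonneg M)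
    (k : K) : (M.map fun s => (s : C(K, ℂ)) k).PosSemidef := by
  obtain ⟨N, hN⟩ := hM
  convert Matrix.posSemidef_conjTranspose_mul_self (N.map fun s => s k) using 1
  ext i j
  have h := congrArg (fun g : C(K, ℂ) => g k) (congrFun (congrFun hN i) j)
  simpa [Matrix.mul_apply] using h

end Matrices

/-! ### Injectivity of `C(K)` for projective `K` -/

section Injectivity

/-- Positive functionals are completely positive: the quadratic form at `x` is `Ω` of a sum of
elements `star y * y`. -/
theorem posSemidef_map_conjTranspose_mul_self {A : Type u} [CStarAlgebra A] [PartialOrder A]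
    [StarOrderedRing A] (Ω : A →ₗ[ℂ] ℂ) (hΩ : ∀ a, 0 ≤ a → 0 ≤ Ω a) {n : ℕ}
    (N : Matrix (Fin n) (Fin n) A) : ((N.conjTranspose * N).map Ω).PosSemidef := by
  have hstar : ∀ a : A, Ω (star a) = star (Ω a) := fun a =>
    (top A).map_star_of_nonneg (Ω ∘ₗ (top A).toSubmodule.subtype) (fun s hs => hΩ s hs) (toTop a)
  refine Matrix.PosSemidef.of_dotProduct_mulVec_nonneg ?_ fun x => ?_
  · ext i j
    simp [Matrix.mul_apply, ← hstar]
  · have h : star x ⬝ᵥ ((N.conjTranspose * N).map Ω).mulVec x =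
        Ω (∑ l, star (∑ i, x i • N l i) * ∑ j, x j • N l j) := by
      simp only [dotProduct, Matrix.mulVec, Matrix.map_apply, Matrix.mul_apply,
        Matrix.conjTranspose_apply, Pi.star_apply, map_sum, star_sum, star_smul,
        smul_mul_smul_comm, map_smul, smul_eq_mul, Finset.mul_sum,
        Finset.sum_mul]
      conv_lhs => enter [2, i]; rw [Finset.sum_comm]
      rw [Finset.sum_comm]
      refine Finset.sum_congr rfl fun l _ => ?_
      rw [Finset.sum_comm]
      refine Finset.sum_congr rfl fun i _ => Finset.sum_congr rfl fun j _ => ?_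
      ring
    rw [h]
    exact hΩ _ (Finset.sum_nonneg fun l _ => star_mul_self_nonneg _)

/-- Extending `φ` amounts to choosing, continuously in `k`, a positive extension of the functional
`s ↦ φ s k`. Projectivity makes the choice by lifting the identity of `K`. -/
theorem isInjective_top_of_projective {K : Type u} [TopologicalSpace K] [CompactSpace K] [T2Space K]
    (hK : CompactT2.Projective K) : (top C(K, ℂ)).IsInjective := by
  intro D _ S T hST φ
  let _ : PartialOrder D := CStarAlgebra.spectralOrder D
  have : StarOrderedRing D := CStarAlgebra.spectralOrderedRing D
  let ω : K → S.Elem →ₗ[ℂ] ℂ := fun k =>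
    { toFun := fun s => (φ s : C(K, ℂ)) k
      map_add' := fun s t => congrArg (fun x : (top C(K, ℂ)).Elem => (x : C(K, ℂ)) k)
        (φ.map_add' s t)
      map_smul' := fun c s => congrArg (fun x : (top C(K, ℂ)).Elem => (x : C(K, ℂ)) k)
        (φ.map_smul' c s) }
  have hω : ∀ k s, ω k s = (φ s : C(K, ℂ)) k := fun _ _ => rfl
  have hωpos : ∀ k (s : S.Elem), 0 ≤ (s : D) → 0 ≤ ω k s := fun k s hs => φ.map_nonneg hs k
  have hω1 : ∀ k, ω k 1 = 1 := fun k =>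
    congrArg (fun x : (top C(K, ℂ)).Elem => (x : C(K, ℂ)) k) φ.map_one'
  -- Pairs of a point `k` and a positive functional extending evaluation of `φ` at `k`. The norm
  -- bound puts `Y` in a product of discs, so it is compact by Tychonoff.
  let Y : Set (K × (D → ℂ)) := {p | (∀ d, ‖p.2 d‖ ≤ 2 * ‖d‖) ∧
    (∀ a b, p.2 (a + b) = p.2 a + p.2 b) ∧ (∀ (c : ℂ) a, p.2 (c • a) = c * p.2 a) ∧
    (∀ a, 0 ≤ a → 0 ≤ p.2 a) ∧ ∀ s : S.Elem, p.2 s = (φ s : C(K, ℂ)) p.1}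
  have hev : ∀ d : D, Continuous fun p : K × (D → ℂ) => p.2 d := fun d =>
    (continuous_apply d).comp continuous_snd
  have hclosed : IsClosed Y := by
    simp only [Y, Set.ofPred_and, Set.ofPred_forall]
    refine .inter (isClosed_iInter fun d => isClosed_le (hev d).norm continuous_const) <|
      .inter (isClosed_iInter fun a => isClosed_iInter fun b =>
        isClosed_eq (hev _) ((hev a).add (hev b))) <|
      .inter (isClosed_iInter fun c => isClosed_iInter fun a =>
        isClosed_eq (hev _) (continuous_const.mul (hev a))) <|
      .inter (isClosed_iInter fun a => isClosed_iInter fun _ =>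
        isClosed_le continuous_const (hev a)) <|
      isClosed_iInter fun s =>
        isClosed_eq (hev _) ((φ s : C(K, ℂ)).continuous.comp continuous_fst)
  have hcompact : IsCompact Y := by
    refine IsCompact.of_isClosed_subset
      (isCompact_univ.prod (isCompact_univ_pi fun d : D => isCompact_closedBall (0 : ℂ) (2 * ‖d‖)))
      hclosed ?_
    rintro p ⟨hp, -⟩
    exact ⟨trivial, fun d _ => mem_closedBall_zero_iff.2 (hp d)⟩
  have : CompactSpace Y := isCompact_iff_compactSpace.1 hcompact
  obtain ⟨h, hh, hfst⟩ := hK (f := (id : K → K)) (g := fun p : Y => p.1.1) continuous_id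
    (continuous_fst.comp continuous_subtype_val) (by
      intro k
      obtain ⟨Ω, h1, h2, h3⟩ := S.exists_functional_extension (ω k) (hωpos k) (hω1 k)
      exact ⟨⟨(k, Ω), h3, map_add Ω, map_smul Ω, h2, h1⟩, rfl⟩)
  have hfst' : ∀ k, (h k).1.1 = k := fun k => congrFun hfst k
  let Ω : K → D →ₗ[ℂ] ℂ := fun k =>
    { toFun := (h k).1.2
      map_add' := (h k).2.2.1
      map_smul' := (h k).2.2.2.1 }
  have hΩc : ∀ d, Continuous fun k => Ω k d := fun d =>
    (hev d).comp (continuous_subtype_val.comp hh)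
  have hΩpos : ∀ k a, 0 ≤ a → 0 ≤ Ω k a := fun k => (h k).2.2.2.2.1
  have hΩS : ∀ k (s : S.Elem), Ω k s = (φ s : C(K, ℂ)) k := fun k s => by
    have := (h k).2.2.2.2.2 s
    rwa [hfst'] at this
  refine ⟨{ toFun := fun t => toTop ⟨fun k => Ω k t, hΩc t⟩
            map_add' := fun a b => Subtype.ext (ContinuousMap.ext fun k => map_add (Ω k) (a : D) b)
            map_smul' := fun c a => Subtype.ext (ContinuousMap.ext fun k => map_smul (Ω k) c (a : D))
            map_one' := Subtype.ext (ContinuousMap.ext fun k => (hΩS k 1).trans (hω1 k))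
            map_matrixNonneg' := ?_ }, ?_⟩
  · rintro n M ⟨N, hN⟩
    refine matrixNonneg_of_posSemidef _ fun k => ?_
    have := posSemidef_map_conjTranspose_mul_self (Ω k) (hΩpos k) N
    rw [← hN] at this
    exact this
  · intro s
    exact Subtype.ext (ContinuousMap.ext fun k => hΩS k s)

end Injectivity

/-! ### Rigidity of essential covers -/

section Rigidity

variable {X K : Type u} [TopologicalSpace X] [TopologicalSpace K]

/-- A real-valued continuous function, regarded as complex-valued. -/
def ContinuousMap.toComplex (h : C(K, ℝ)) : C(K, ℂ) :=
  ⟨fun k => (h k : ℂ), Complex.continuous_ofReal.comp h.continuous⟩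

variable [CompactSpace X] [T2Space X] [CompactSpace K]

/-- A unital completely positive map on `C(K)` fixing `C(X)` is controlled by the fibres of `f`. -/
theorem UCPMap.re_apply_le_of_forall_fiber_lt {f : C(K, X)}
    (φ : UCPMap (top C(K, ℂ)) (top C(K, ℂ)))
    (hφ : ∀ g : C(X, ℂ), φ (toTop (g.comp f)) = toTop (g.comp f)) (h : C(K, ℝ)) (k : K) (d : ℝ)
    (hd : ∀ y, f y = f k → h y < d) : ((φ (toTop h.toComplex) : C(K, ℂ)) k).re ≤ d := by
  have hF : IsClosed (f '' {y | d ≤ h y}) :=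
    ((isClosed_le continuous_const h.continuous).isCompact.image f.continuous).isClosed
  have hdisj : Disjoint {f k} (f '' {y | d ≤ h y}) := by
    rw [Set.disjoint_singleton_left]
    rintro ⟨y, hy, hyk⟩
    exact (hd y hyk).not_ge hy
  obtain ⟨g, hg0, hg1, hg01⟩ := exists_continuous_zero_one_of_isClosed isClosed_singleton hF hdisj
  -- Large enough that `h ≤ d + c * (g ∘ f)` also where `h ≥ d`, where `g ∘ f = 1`. Applying `φ` and
  -- evaluating at `k`, where `g ∘ f = 0`, leaves `d`.
  set c : ℝ := ‖h‖ + |d|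
  let p : (top C(K, ℂ)).Elem :=
    (d : ℂ) • 1 + (c : ℂ) • toTop (g.toComplex.comp f) - toTop h.toComplex
  have hp : 0 ≤ (p : C(K, ℂ)) := by
    intro y
    have e : (p : C(K, ℂ)) y = ((d + c * g (f y) - h y : ℝ) : ℂ) := by
      push_cast
      change (d : ℂ) * 1 + c * g (f y) - h y = _
      ring
    change (0 : ℂ) ≤ (p : C(K, ℂ)) y
    rw [e]
    simp only [Complex.zero_le_real]
    have h1 : h y ≤ ‖h‖ := (le_abs_self _).trans (h.norm_coe_le_norm y)
    by_cases hy : d ≤ h y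
    · have : g (f y) = 1 := hg1 ⟨y, hy, rfl⟩
      rw [this]
      have := neg_abs_le d
      simp only [c]
      linarith
    · have h2 : 0 ≤ c * g (f y) := mul_nonneg (by positivity) (hg01 _).1
      linarith
  have e : φ p = (d : ℂ) • 1 + (c : ℂ) • toTop (g.toComplex.comp f) - φ (toTop h.toComplex) := by
    change φ.toLinearMap p = _
    rw [map_sub, map_add, map_smul, map_smul]
    exact congrArg₂ (fun u v => (d : ℂ) • u + (c : ℂ) • v - φ (toTop h.toComplex)) φ.map_one'
      (hφ g.toComplex)
  have h1 : 0 ≤ (φ p : C(K, ℂ)) k := φ.map_nonneg hp k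
  rw [e] at h1
  have hgk : g (f k) = 0 := hg0 rfl
  have h2 : 0 ≤ (d : ℂ) * 1 + c * (g (f k) : ℂ) - (φ (toTop h.toComplex) : C(K, ℂ)) k := h1
  have h3 := (Complex.nonneg_iff.1 h2).1
  rw [hgk] at h3
  simp only [mul_one, Complex.ofReal_zero, mul_zero, add_zero, Complex.sub_re,
    Complex.ofReal_re] at h3
  linarith

variable [T2Space K]

/-- If the bound failed at `k`, with `c` strictly between the two values, the closed set `F` where
`h ≥ c` or `Re (φ h) ≤ c` would miss `k`. By essentiality `F` then misses a whole fibre. There `h <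
c`, so the fibre bound gives `Re (φ h) ≤ c`, a contradiction. -/
theorem UCPMap.re_apply_le_of_isEssentialCover {f : C(K, X)} (hf : IsEssentialCover f)
    (φ : UCPMap (top C(K, ℂ)) (top C(K, ℂ)))
    (hφ : ∀ g : C(X, ℂ), φ (toTop (g.comp f)) = toTop (g.comp f)) (h : C(K, ℝ)) (k : K) :
    ((φ (toTop h.toComplex) : C(K, ℂ)) k).re ≤ h k := by
  by_contra! hlt
  obtain ⟨c, hc1, hc2⟩ := exists_between hlt
  let u : K → ℝ := fun y => ((φ (toTop h.toComplex) : C(K, ℂ)) y).re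
  have hu : Continuous u :=
    Complex.continuous_re.comp (φ (toTop h.toComplex) : C(K, ℂ)).continuous
  let F : Set K := {y | c ≤ h y} ∪ {y | u y ≤ c}
  have hF : IsClosed F :=
    (isClosed_le continuous_const h.continuous).union (isClosed_le hu continuous_const)
  have : CompactSpace F := isCompact_iff_compactSpace.1 hF.isCompact
  have hns : ¬ Function.Surjective (f ∘ (⟨Subtype.val, continuous_subtype_val⟩ : C(F, K))) := by
    intro hs
    obtain ⟨⟨y, hy⟩, rfl⟩ := hf.2 F _ hs k
    rcases hy with hy | hy
    · exact hc1.not_ge hy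
    · exact hc2.not_ge hy
  simp only [Function.Surjective, not_forall, not_exists] at hns
  obtain ⟨x, hx⟩ := hns
  obtain ⟨y, rfl⟩ := hf.1 x
  have hfib : ∀ z, f z = f y → z ∉ F := fun z hz hzF => hx ⟨z, hzF⟩ hz
  have h1 : u y ≤ c := φ.re_apply_le_of_forall_fiber_lt hφ h y c fun z hz => by
    by_contra! hcz
    exact hfib z hz (Or.inl hcz)
  exact hfib y rfl (Or.inr h1)

theorem UCPMap.apply_eq_of_isEssentialCover {f : C(K, X)} (hf : IsEssentialCover f)
    (φ : UCPMap (top C(K, ℂ)) (top C(K, ℂ)))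
    (hφ : ∀ g : C(X, ℂ), φ (toTop (g.comp f)) = toTop (g.comp f)) (x : (top C(K, ℂ)).Elem) :
    φ x = x := by
  have hreal : ∀ h : C(K, ℝ), φ (toTop h.toComplex) = toTop h.toComplex := by
    intro h
    refine Subtype.ext (ContinuousMap.ext fun k => ?_)
    have h1 := φ.re_apply_le_of_isEssentialCover hf hφ h k
    have h2 := φ.re_apply_le_of_isEssentialCover hf hφ (-h) k
    have e1 : toTop (-h).toComplex = -toTop h.toComplex :=
      Subtype.ext (ContinuousMap.ext fun k => Complex.ofReal_neg (h k))
    have e2 : φ (-toTop h.toComplex) = -φ (toTop h.toComplex) := map_neg φ.toLinearMap _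
    have e3 : ((-φ (toTop h.toComplex) : (top C(K, ℂ)).Elem) : C(K, ℂ)) k =
      -(φ (toTop h.toComplex) : C(K, ℂ)) k := rfl
    rw [e1, e2, e3, Complex.neg_re, ContinuousMap.neg_apply, neg_le_neg_iff] at h2
    have e4 : star (toTop h.toComplex) = toTop h.toComplex :=
      Subtype.ext (ContinuousMap.ext fun k => Complex.conj_ofReal (h k))
    have e5 := φ.map_star (toTop h.toComplex)
    rw [e4] at e5
    have e6 : (φ (toTop h.toComplex) : C(K, ℂ)) k =
      (starRingEnd ℂ) ((φ (toTop h.toComplex) : C(K, ℂ)) k) :=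
        congrArg (fun z : (top C(K, ℂ)).Elem => (z : C(K, ℂ)) k) e5
    have e7 := Complex.conj_eq_iff_im.1 e6.symm
    exact Complex.ext (le_antisymm h1 h2) e7
  let a : C(K, ℝ) := ⟨fun k => ((x : C(K, ℂ)) k).re,
    Complex.continuous_re.comp (x : C(K, ℂ)).continuous⟩
  let b : C(K, ℝ) := ⟨fun k => ((x : C(K, ℂ)) k).im,
    Complex.continuous_im.comp (x : C(K, ℂ)).continuous⟩
  have hx : x = toTop a.toComplex + Complex.I • toTop b.toComplex :=
    Subtype.ext (ContinuousMap.ext fun k =>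
      ((Complex.re_add_im _).symm.trans (congrArg _ (mul_comm _ _))))
  have e : φ (toTop a.toComplex + Complex.I • toTop b.toComplex) =
      φ (toTop a.toComplex) + Complex.I • φ (toTop b.toComplex) := by
    change φ.toLinearMap _ = _
    rw [map_add, map_smul]
    rfl
  rw [hx, e, hreal, hreal]

end Rigidity

/-! ### Extensions along complete order embeddings -/

section Extension

variable {A B D : Type u} [CStarAlgebra A] [CStarAlgebra B] [CStarAlgebra D]
  {S : OperatorSystem A} {T : OperatorSystem B} {I : OperatorSystem D}

/-- The identity of an operator system. -/
noncomputable def UCPMap.id (S : OperatorSystem A) : UCPMap S S where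
  toLinearMap := LinearMap.id
  map_one' := rfl
  map_matrixNonneg' _ _ hM := hM

/-- Composition of unital completely positive maps. -/
noncomputable def UCPMap.comp (ψ : UCPMap T I) (φ : UCPMap S T) : UCPMap S I where
  toLinearMap := ψ.toLinearMap ∘ₗ φ.toLinearMap
  map_one' := (congrArg ψ φ.map_one').trans ψ.map_one'
  map_matrixNonneg' n M hM := ψ.map_matrixNonneg' n _ (φ.map_matrixNonneg' n M hM)

theorem UCPMap.IsCompleteOrderEmbedding.injective {κ : UCPMap S T}
    (hκ : κ.IsCompleteOrderEmbedding) : Function.Injective κ.toLinearMap := by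
  let _ : PartialOrder A := CStarAlgebra.spectralOrder A
  have : StarOrderedRing A := CStarAlgebra.spectralOrderedRing A
  let _ : PartialOrder B := CStarAlgebra.spectralOrder B
  have : StarOrderedRing B := CStarAlgebra.spectralOrderedRing B
  have key : ∀ s : S.Elem, κ.toLinearMap s = 0 → 0 ≤ (s : A) := by
    intro s hs
    refine (S.matrixNonneg_fin_one_iff s).1 (hκ 1 _ ?_)
    refine (T.matrixNonneg_fin_one_iff (κ s)).2 ?_
    rw [show κ s = 0 from hs]
    exact le_rfl
  rw [← LinearMap.ker_eq_bot, LinearMap.ker_eq_bot']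
  intro s hs
  refine Subtype.ext (le_antisymm ?_ (key s hs))
  have := key (-s) (by rw [map_neg, hs, neg_zero])
  rw [show ((-s : S.Elem) : A) = -(s : A) from rfl, neg_nonneg] at this
  exact this

/-- The range of a unital completely positive map, as an operator system. -/
noncomputable def UCPMap.range (κ : UCPMap S T) (hκ : ∀ s, κ (star s) = star (κ s)) : OperatorSystem B where
  toSubmodule := LinearMap.range (T.toSubmodule.subtype ∘ₗ κ.toLinearMap)
  one_mem' := ⟨1, congrArg Subtype.val κ.map_one'⟩
  star_mem' := by
    rintro _ ⟨s, rfl⟩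
    exact ⟨star s, congrArg Subtype.val (hκ s)⟩

/-- Injectivity is stated for subsystems only. A complete order embedding has a completely positive
inverse on its range, so `φ` transports to that range and extends from there. -/
theorem UCPMap.IsCompleteOrderEmbedding.exists_extension {κ : UCPMap S T}
    (hκ : κ.IsCompleteOrderEmbedding) (hI : I.IsInjective) (φ : UCPMap S I) :
    ∃ ψ : UCPMap T I, ∀ s, ψ (κ s) = φ s := by
  have hstar : ∀ s, κ (star s) = star (κ s) := by
    let _ : PartialOrder A := CStarAlgebra.spectralOrder A
    have : StarOrderedRing A := CStarAlgebra.spectralOrderedRing A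
    let _ : PartialOrder B := CStarAlgebra.spectralOrder B
    have : StarOrderedRing B := CStarAlgebra.spectralOrderedRing B
    exact κ.map_star
  let R := κ.range hstar
  have hinj : Function.Injective (T.toSubmodule.subtype ∘ₗ κ.toLinearMap) :=
    Subtype.val_injective.comp hκ.injective
  let e : S.Elem ≃ₗ[ℂ] R.Elem := LinearEquiv.ofInjective _ hinj
  have he : ∀ s, (e s : B) = κ s := fun s => rfl
  have hes : ∀ r : R.Elem, (κ (e.symm r) : B) = r := fun r => by
    rw [← he, e.apply_symm_apply]
  have hRT : R.toSubmodule ≤ T.toSubmodule := by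
    rintro _ ⟨s, rfl⟩
    exact (κ s).2
  let φ' : UCPMap R I :=
    { toLinearMap := φ.toLinearMap ∘ₗ e.symm.toLinearMap
      map_one' := by
        have : e.symm 1 = 1 := by
          rw [LinearEquiv.symm_apply_eq]
          exact Subtype.ext (congrArg Subtype.val κ.map_one').symm
        exact (congrArg φ this).trans φ.map_one'
      map_matrixNonneg' := by
        rintro n M ⟨N, hN⟩
        refine φ.map_matrixNonneg' n (M.map e.symm) (hκ n _ ⟨N, ?_⟩)
        rw [← hN]
        ext i j
        exact hes (M i j) }
  obtain ⟨ψ, hψ⟩ := hI B R T hRT φ'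
  refine ⟨ψ, fun s => ?_⟩
  have h := hψ (e s)
  have h1 : Submodule.inclusion hRT (e s) = κ s := rfl
  have h2 : φ' (e s) = φ s := congrArg φ (e.symm_apply_apply s)
  rwa [h1, h2] at h

end Extension

/-! ### The injective envelope of `C(X)` -/

section Envelope

theorem pullbackUCP_isCompleteOrderEmbedding {X K : Type u} [TopologicalSpace X] [CompactSpace X]
    [TopologicalSpace K] [CompactSpace K] (f : C(K, X)) (hf : Function.Surjective f) :
    (pullbackUCP f).IsCompleteOrderEmbedding := by
  intro n M hM
  refine matrixNonneg_of_posSemidef M fun x => ?_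
  obtain ⟨k, rfl⟩ := hf x
  exact posSemidef_of_matrixNonneg hM k

theorem pullbackUCP_isInjectiveEnvelope {X K : Type u} [TopologicalSpace X] [CompactSpace X]
    [T2Space X] [TopologicalSpace K] [CompactSpace K] [T2Space K] (f : C(K, X))
    (hf : IsProjectiveCover f) : (pullbackUCP f).IsInjectiveEnvelope where
  embedding := pullbackUCP_isCompleteOrderEmbedding f hf.1.1
  injective := isInjective_top_of_projective hf.2
  rigid φ hφ := φ.apply_eq_of_isEssentialCover hf.1 fun g => hφ (toTop g)

theorem OperatorSystem.IsInjective.exists_isRetraction {A : Type u} [CStarAlgebra A]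
    {I : OperatorSystem A} (hI : I.IsInjective) :
    ∃ Φ : UCPMap (top A) I, Φ.IsRetraction :=
  hI A I (top A) le_top (UCPMap.id I)

variable {A B : Type u} [CStarAlgebra A] [CStarAlgebra B] [PartialOrder A] [StarOrderedRing A]
  [PartialOrder B] [StarOrderedRing B]

/-- If `Ψ ∘ θ = id` then `Ψ` sends `θ(a)⋆ θ(b)` to `a⋆ b`. -/
theorem UCPMap.apply_star_mul_of_leftInverse {I : OperatorSystem A} (θ : UCPMap (top B) I)
    (Ψ : UCPMap (top A) (top B)) (h : ∀ b : B, Ψ (toTop (θ (toTop b) : A)) = toTop b) (a b : B) :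
    Ψ (toTop (star (θ (toTop a) : A) * (θ (toTop b) : A))) = toTop (star a * b) := by
  let t : B →ₗ[ℂ] A := I.toSubmodule.subtype ∘ₗ θ.toLinearMap ∘ₗ
    (LinearMap.id.codRestrict ⊤ fun _ => trivial)
  let P : A →ₗ[ℂ] B := (top B).toSubmodule.subtype ∘ₗ Ψ.toLinearMap ∘ₗ
    (LinearMap.id.codRestrict ⊤ fun _ => trivial)
  have ht : ∀ b, (θ (toTop b) : A) = t b := fun _ => rfl
  have hP : ∀ x, (Ψ (toTop x) : B) = P x := fun _ => rfl
  have hPt : ∀ b, P (t b) = b := fun b => congrArg Subtype.val (h b)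
  have hpos : ∀ x, 0 ≤ x → 0 ≤ P x := fun x hx => Ψ.map_nonneg (s := toTop x) hx
  -- Kadison–Schwarz for `θ`, pushed through `P`, gives one inequality; Kadison–Schwarz for `Ψ`
  -- gives the other. Polarization with `a + b` and `a + I • b` then handles mixed products.
  have hdiag : ∀ c, P (star (t c) * t c) = star c * c := by
    intro c
    refine le_antisymm ?_ ?_
    · have h1 : star (t c) * t c ≤ t (star c * c) := θ.star_mul_le c
      have h2 := hpos _ (sub_nonneg.2 h1)
      rwa [map_sub, hPt, sub_nonneg] at h2
    · have h1 : star (P (t c)) * P (t c) ≤ P (star (t c) * t c) := Ψ.star_mul_le (t c)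
      rwa [hPt] at h1
  refine Subtype.ext ?_
  change P (star (t a) * t b) = star a * b
  have h1 := hdiag (a + b)
  have h2 := hdiag (a + Complex.I • b)
  simp only [map_add, map_smul, star_add, star_smul, add_mul, mul_add, smul_mul_assoc,
    mul_smul_comm, hdiag] at h1 h2
  have e1 : P (star (t a) * t b) + P (star (t b) * t a) = star a * b + star b * a := by
    have := congrArg (fun z => z - star a * a - star b * b) h1
    calc _ = _ := by abel
      _ = _ := this
      _ = _ := by abel
  have e2 : P (star (t a) * t b) - P (star (t b) * t a) = star a * b - star b * a := by
    have := congrArg (fun z => (-Complex.I) • (z - star a * a - star b * b)) h2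
    simp only [RCLike.star_def, Complex.conj_I, neg_smul, smul_sub, smul_add, smul_neg, smul_smul,
      neg_mul, Complex.I_mul_I, neg_neg, one_smul] at this
    calc _ = _ := by abel
      _ = _ := this
      _ = _ := by abel
  have e3 : (2 : ℂ) • P (star (t a) * t b) = (2 : ℂ) • (star a * b) := by
    rw [two_smul, two_smul]
    calc _ = (P (star (t a) * t b) + P (star (t b) * t a)) +
          (P (star (t a) * t b) - P (star (t b) * t a)) := by abel
      _ = _ := by rw [e1, e2]; abel
  exact smul_right_injective B two_ne_zero e3

end Envelope

theorem corollary2p18 {X K : Type u} [TopologicalSpace X] [CompactSpace X] [T2Space X]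
    [TopologicalSpace K] [CompactSpace K] [T2Space K] (f : C(K, X)) (hf : IsProjectiveCover f) :
    (pullbackUCP f).IsInjectiveEnvelope ∧
    ∀ (A : Type u) [CStarAlgebra A] (I : OperatorSystem A)
      (κ : UCPMap (OperatorSystem.top C(X, ℂ)) I), κ.IsInjectiveEnvelope →
      (∃ Φ : UCPMap (OperatorSystem.top A) I, Φ.IsRetraction) ∧
      ∃ θ : UCPMap (OperatorSystem.top C(K, ℂ)) I,
        θ.IsCompleteOrderEmbedding ∧
        (∀ a : C(K, ℂ), ‖(θ (OperatorSystem.toTop a) : A)‖ = ‖a‖) ∧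
        (∀ g : C(X, ℂ),
          θ (OperatorSystem.toTop (g.comp f)) = κ (OperatorSystem.toTop g)) ∧
        ∀ Φ : UCPMap (OperatorSystem.top A) I, Φ.IsRetraction →
          ∃ e : C(K, ℂ) ≃⋆ₐ[ℂ] ChoiEffros I Φ,
            ∀ a : C(K, ℂ), (e a).toElem = θ (OperatorSystem.toTop a) := by
  have hpi := pullbackUCP_isInjectiveEnvelope f hf
  refine ⟨hpi, fun A _ I κ hκ => ?_⟩
  let _ : PartialOrder A := CStarAlgebra.spectralOrder A
  have : StarOrderedRing A := CStarAlgebra.spectralOrderedRing A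
  obtain ⟨θ, hθ⟩ := hpi.embedding.exists_extension hκ.injective κ
  obtain ⟨ψ, hψ⟩ := hκ.embedding.exists_extension hpi.injective (pullbackUCP f)
  have hψθ : ∀ x, ψ (θ x) = x := hpi.rigid (ψ.comp θ) fun s =>
    (congrArg ψ (hθ s)).trans (hψ s)
  have hθψ : ∀ x, θ (ψ x) = x := hκ.rigid (θ.comp ψ) fun s =>
    (congrArg θ (hψ s)).trans (hθ s)
  obtain ⟨Φ₀, hΦ₀⟩ := hκ.injective.exists_isRetraction
  refine ⟨⟨Φ₀, hΦ₀⟩, θ, ?_, ?_, fun g => hθ (toTop g), ?_⟩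
  · intro n M hM
    have h := ψ.map_matrixNonneg' n _ hM
    convert h using 1
    ext1 i j
    exact (hψθ (M i j)).symm
  · intro a
    refine le_antisymm (θ.norm_apply_le a) ?_
    have h := (ψ.comp Φ₀).norm_apply_le (θ (toTop a) : A)
    have e : (ψ.comp Φ₀) (toTop (θ (toTop a) : A)) = toTop a :=
      (congrArg ψ (hΦ₀ (θ (toTop a)))).trans (hψθ (toTop a))
    rwa [e] at h
  · intro Φ hΦ
    have hΨ : ∀ b, (ψ.comp Φ) (toTop (θ (toTop b) : A)) = toTop b := fun b =>
      (congrArg ψ (hΦ (θ (toTop b)))).trans (hψθ (toTop b))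
    have hstar : ∀ a : C(K, ℂ), θ (toTop (star a)) = star (θ (toTop a)) := fun a =>
      θ.map_star (toTop a)
    -- `ψ ∘ Φ` is a left inverse of `θ`, so it sends `θ a * θ b` to `a * b`; applying `θ` and `θ ∘ ψ
    -- = id` isolates `Φ`.
    have hmul : ∀ a b : C(K, ℂ), θ (toTop (a * b)) =
        Φ (toTop ((θ (toTop a) : A) * (θ (toTop b) : A))) := by
      intro a b
      have h := θ.apply_star_mul_of_leftInverse (ψ.comp Φ) hΨ (star a) b
      rw [star_star, hstar] at h
      have e : star ((star (θ (toTop a)) : I.Elem) : A) = (θ (toTop a) : A) :=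
        star_star (θ (toTop a) : A)
      rw [e] at h
      exact (congrArg θ h).symm.trans (hθψ _)
    exact ⟨{ toFun := fun a => (θ (toTop a) : I.Elem)
             invFun := fun x => ((ψ x.toElem : (top C(K, ℂ)).Elem) : C(K, ℂ))
             left_inv := fun a => congrArg Subtype.val (hψθ (toTop a))
             right_inv := fun x => hθψ x.toElem
             map_add' := fun a b => θ.map_add' (toTop a) (toTop b)
             map_mul' := hmul
             map_star' := hstar
             map_smul' := fun c a => θ.map_smul' c (toTop a) }, fun _ => rfl⟩
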